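/- Conventions. Let $\mathbb F_q$ be a field with $q$ elements. A matrix $G(D)\in\mathbb F_q[D]^{k\times n}$ is basic if it has a polynomial right inverse. Its overall constraint length is the sum over its rows of the largest degree of an entry of the row, and its memory is the largest degree of an entry. It is reduced basic if it is basic and its overall constraint length is the smallest among all basic matrices whose rows generate the same submodule of $\mathbb F_q[D]^n$. The convolutional code generated by $G(D)$ is the submodule generated by its rows. The Euclidean dual of a convolutional code $V$ is $V^\perp=\{u(D)\in\mathbb F_q[D]^n : u(D)\cdot v(1/D)=0 \text{ for all } v(D)\in V\}$. The weight of a polynomial vector is the total number of nonzero coefficients of its components. An asymmetric quantum convolutional code (AQCC) with parameters $[(n,k,\mu;\gamma,(d_z)_f/(d_x)_f)]_q$ is given by a reduced basic stabilizer matrix $S(D)=(X(D)\mid Z(D))\in\mathbb F_q[D]^{(n-k)\times 2n}$ with $X(D)Z(1/D)^{t}-Z(D)X(1/D)^{t}=0$, with memory $\mu$ and overall constraint length $\gamma$ (the degree of the code). Here $(d_z)_f$ is the smallest weight of a phase-shift error $(0\mid z(D))$ that is symplectically orthogonal to all shifts of all rows of $S(D)$ but does not lie in the module generated by the rows of $S(D)$,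 and $(d_x)_f$ is the smallest weight of a qudit-flip error $(x(D)\mid 0)$ with the same property. An AQCC of frame size $n=q-1$ is said here to be derived from a Reed–Solomon (RS) code if it arises as follows. Let $\alpha$ be a primitive element of $\mathbb F_q$, let $b\ge 0$ and $1\le m\le n-1$ be integers, and let $H$ be the parity check matrix of an RS code whose rows are $(1,\alpha^{c},\alpha^{2c},\dots,\alpha^{(n-1)c})$ for $c=b,\dots,b+m-1$. The rows of $H$ are split into disjoint submatrices $H_0,\dots,H_\nu$, where each $H_l$ with $l\ge 1$ is filled up with zero rows to the number of rows of $H_0$, giving $\tilde H_l$, and $G_1(D)=H_0+\tilde H_1D+\dots+\tilde H_\nu D^{\nu}$ (the order of the rows in each block and the places of the zero rows are arbitrary) is reduced basic. The matrix $G_2(D)$ consists of some of the rows of $G_1(D)$ and is reduced basic. The matrix $H_1(D)$ is a reduced basic generator matrix of the Euclidean dual of the convolutional code generated by $G_1(D)$. The stabilizer matrix is $$\left(\begin{array}{c|c} H_1(D) & 0\\ 0 & G_2(D)\end{array}\right).$$ Theorem. Let $q\ge 8$ be a prime power. (a) For all integers $i,t$ with $3\le i\le q-3$ and $1\le t\le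 i-2$ there exists an AQCC derived from an RS code with parameters $[(q-1,\ i-t-1,\ \mu^*;\ 3,\ (d_z)_f/(d_x)_f)]_q$ for some memory $\mu^*$, where $(d_z)_f\ge q-i-1$ and $(d_x)_f\ge t+2$. (b) For all integers $i,t$ with $2\le i\le q-3$ and $1\le t\le i-1$ there exists an AQCC derived from an RS code with parameters $[(q-1,\ i-t,\ \mu^*;\ 2,\ (d_z)_f/(d_x)_f)]_q$ for some memory $\mu^*$, where $(d_z)_f\ge q-i-1$ and $(d_x)_f\ge t+2$. -/

import Mathlib

open Polynomial LaurentPolynomial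

namespace AQCC

/-! ### Classical convolutional codes -/

section Classical

variable {F : Type*} [Field F] {ι κ : Type*} [Fintype ι] [Fintype κ]

/-- The submodule of `F[D]^κ` generated by the rows of `G(D)`. -/
noncomputable def rowModule (G : Matrix ι κ F[X]) : Submodule F[X] (κ → F[X]) :=
  Submodule.span F[X] (Set.range fun r : ι => G r)

/-- `G(D)` is basic: it has a polynomial right inverse. -/
def IsBasic [DecidableEq ι] (G : Matrix ι κ F[X]) : Prop :=
  ∃ R : Matrix κ ι F[X], G * R = 1

/-- The constraint length of the `r`-th row: the largest degree of its entries. -/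
def rowDegree (G : Matrix ι κ F[X]) (r : ι) : ℕ :=
  Finset.univ.sup fun j : κ => (G r j).natDegree

/-- The overall constraint length: the sum of the constraint lengths of the rows. -/
def overallConstraintLength (G : Matrix ι κ F[X]) : ℕ :=
  ∑ r : ι, rowDegree G r

/-- The memory: the largest constraint length of a row. -/
def memory (G : Matrix ι κ F[X]) : ℕ :=
  Finset.univ.sup fun r : ι => rowDegree G r

/-- `G(D)` is reduced basic: it is basic, and its overall constraint length is the smallest among
all basic generator matrices of the same module. -/
def IsReducedBasic [DecidableEq ι] (G : Matrix ι κ F[X]) : Prop :=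
  IsBasic G ∧ ∀ G' : Matrix ι κ F[X], IsBasic G' → rowModule G' = rowModule G →
    overallConstraintLength G ≤ overallConstraintLength G'

/-- The weight of `v(D)`: the total number of nonzero coefficients of its components. -/
def weight (v : κ → F[X]) : ℕ :=
  ∑ j : κ, (v j).support.card

/-- The Laurent polynomial `u(D) · v(1/D)`. Its coefficient at `D ^ s` is `∑ᵢ u_{i+s} · v_i`, that
is, the Euclidean inner product of `u(D)` with the shift of `v(D)` by `s` frames. -/
noncomputable def shiftProduct (u v : κ → F[X]) : F[T;T⁻¹] :=
  ∑ j : κ, toLaurent (u j) * invert (toLaurent (v j))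

/-- The Euclidean dual code: all `u(D)` that are orthogonal to every shift (forward or backward)
of every codeword. It is the largest submodule of `F[D]^κ` whose elements are all orthogonal to
all codewords. -/
noncomputable def euclideanDual (V : Submodule F[X] (κ → F[X])) : Submodule F[X] (κ → F[X]) where
  carrier := {u | ∀ v ∈ V, shiftProduct u v = 0}
  zero_mem' := fun v _ => by simp [shiftProduct]
  add_mem' := fun {a b} ha hb v hv => by
    have h1 := ha v hv
    have h2 := hb v hv
    simp only [shiftProduct] at h1 h2
    simp [shiftProduct, add_mul, Finset.sum_add_distrib, h1, h2]
  smul_mem' := fun c u hu v hv => by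
    have h := hu v hv
    simp only [shiftProduct] at h
    simp [shiftProduct, mul_assoc, ← Finset.mul_sum, h]

end Classical

/-! ### Asymmetric quantum convolutional codes

A stabilizer matrix `S(D) = (X(D) | Z(D))` with frame size `n` has columns indexed by
`Fin n ⊕ Fin n`; the left summand carries `X(D)`, the right one `Z(D)`. A finitely supported error
on the stream of qudits is given in the same way (up to a global phase and a shift of the frames)
by a vector `e(D) = (x(D) | z(D))`. -/

section Quantum

variable {F : Type*} [Field F] {n : ℕ} {ι : Type*} [Fintype ι]

/-- The symplectic product `x(D) · z'(1/D) - z(D) · x'(1/D)` of `(x | z)` and `(x' | z')`. It is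
zero iff the two operators commute, together with all their shifts. -/
noncomputable def symplecticProduct (e e' : Fin n ⊕ Fin n → F[X]) : F[T;T⁻¹] :=
  shiftProduct (fun j => e (Sum.inl j)) (fun j => e' (Sum.inr j)) -
    shiftProduct (fun j => e (Sum.inr j)) (fun j => e' (Sum.inl j))

/-- The errors that a stabilizer code does not detect: they commute with the whole stabilizer,
but do not belong to it. -/
def undetectable (S : Matrix ι (Fin n ⊕ Fin n) F[X]) : Set (Fin n ⊕ Fin n → F[X]) :=
  {e | (∀ r : ι, symplecticProduct e (S r) = 0) ∧ e ∉ rowModule S}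

/-- The weights of the undetectable phase-shift errors, i.e. those of the form `(0 | z(D))`. -/
def phaseWeights (S : Matrix ι (Fin n ⊕ Fin n) F[X]) : Set ℕ :=
  {w | ∃ z : Fin n → F[X], (Sum.elim 0 z : Fin n ⊕ Fin n → F[X]) ∈ undetectable S ∧ weight z = w}

/-- The weights of the undetectable qudit-flip errors, i.e. those of the form `(x(D) | 0)`. -/
def flipWeights (S : Matrix ι (Fin n ⊕ Fin n) F[X]) : Set ℕ :=
  {w | ∃ x : Fin n → F[X], (Sum.elim x 0 : Fin n ⊕ Fin n → F[X]) ∈ undetectable S ∧ weight x = w}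

/-- `S(D)` is a stabilizer matrix of an asymmetric quantum convolutional code with parameters
`[(n, k, μ; γ, dz / dx)]`: frame size `n`, `k` logical qudits per frame, memory `μ`, degree `γ`,
free distance `dz` for phase-shift errors and free distance `dx` for qudit-flip errors. -/
structure HasParameters [DecidableEq ι] (S : Matrix ι (Fin n ⊕ Fin n) F[X])
    (k μ γ dz dx : ℕ) : Prop where
  card_rows : Fintype.card ι + k = n
  self_orthogonal : ∀ r s : ι, symplecticProduct (S r) (S s) = 0
  reduced_basic : IsReducedBasic S
  degree_eq : overallConstraintLength S = γ
  memory_eq : memory S = μ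
  dz_isLeast : IsLeast (phaseWeights S) dz
  dx_isLeast : IsLeast (flipWeights S) dx

/-- The CSS stabilizer matrix with blocks `(A(D) | 0)` and `(0 | B(D))`. -/
noncomputable def cssMatrix {ι₁ ι₂ : Type*} (A : Matrix ι₁ (Fin n) F[X]) (B : Matrix ι₂ (Fin n) F[X]) :
    Matrix (ι₁ ⊕ ι₂) (Fin n ⊕ Fin n) F[X] :=
  Matrix.fromBlocks A 0 0 B

end Quantum

/-! ### Codes derived from Reed-Solomon codes -/

section ReedSolomon

variable {F : Type*} [Field F]

/-- The parity check matrix with rows `(1, α^c, α^(2c), …, α^((n-1)c))`, for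
`c = b, b + 1, …, b + m - 1`. If `α` is a primitive element of a field with `n + 1` elements and
`1 ≤ m ≤ n - 1`, it defines the Reed-Solomon code `[n, n - m, m + 1]`. -/
def rsParityCheck (α : F) (b m n : ℕ) : Matrix (Fin m) (Fin n) F :=
  Matrix.of fun s j => α ^ ((j : ℕ) * (b + (s : ℕ)))

/-- `G(D) = H̃₀ + H̃₁ D + ⋯ + H̃_μ D^μ` arises by splitting the rows of `H` into disjoint submatrices
`H₀, …, H_μ` and filling them up with zero rows: row `s` of `H` is placed in row `row s` of the
coefficient of `D ^ deg s`, no place is used twice, and `H₀` needs no zero rows. -/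
def IsSplitting {m k n : ℕ} (H : Matrix (Fin m) (Fin n) F) (G : Matrix (Fin k) (Fin n) F[X]) :
    Prop :=
  ∃ (row : Fin m → Fin k) (deg : Fin m → ℕ),
    (Function.Injective fun s => (row s, deg s)) ∧
    (∀ r : Fin k, ∃ s, row s = r ∧ deg s = 0) ∧
    ∀ (r : Fin k) (j : Fin n),
      G r j = ∑ s : Fin m, if row s = r then monomial (deg s) (H s j) else 0

/-- `V₂ ⊂ V₁` are convolutional codes derived from a Reed-Solomon code of length `n` over `F`, and
the CSS construction applied to them gives an asymmetric quantum convolutional code with parameters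
`[(n, k, μ; γ, dz / dx)]`. Here `V₁` is generated by a reduced basic matrix `G₁(D)` that arises by
splitting the parity check matrix of the Reed-Solomon code, `V₂` is generated by a reduced basic
matrix `G₂(D)` that consists of rows of `G₁(D)`, and the stabilizer matrix has the blocks
`(H₁(D) | 0)` and `(0 | G₂(D))`, where `H₁(D)` is a reduced basic generator matrix of the Euclidean
dual of `V₁`. -/
def IsRSDerivedAQCC (F : Type*) [Field F] [Fintype F] (n k μ γ dz dx : ℕ) : Prop :=
  n + 1 = Fintype.card F ∧
  ∃ (α : F) (b m : ℕ) (k₁ k₂ r : ℕ) (G₁ : Matrix (Fin k₁) (Fin n) F[X])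
    (G₂ : Matrix (Fin k₂) (Fin n) F[X]) (H₁ : Matrix (Fin r) (Fin n) F[X]),
    IsPrimitiveRoot α n ∧ 1 ≤ m ∧ m + 1 ≤ n ∧
    IsSplitting (rsParityCheck α b m n) G₁ ∧ IsReducedBasic G₁ ∧
    (∃ f : Fin k₂ ↪ Fin k₁, G₂ = G₁.submatrix f id) ∧ IsReducedBasic G₂ ∧
    IsReducedBasic H₁ ∧ rowModule H₁ = euclideanDual (rowModule G₁) ∧
    HasParameters (cssMatrix H₁ G₂) k μ γ dz dx

end ReedSolomon

end AQCC

/-!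
Let `n = q - 1` and let `w_c = (1, α ^ c, α ^ (2 c), …)` for `0 ≤ c < n`. These vectors are the rows
of an invertible Vandermonde matrix; let `w'_c` be the dual basis of `F ^ n`. Only splittings of
memory one are needed: the rows of `G₁(D)` are vectors `w_a`, except for one or two rows
`w_a + D w_b`, with all exponents different. An element `u(D)` is orthogonal to all shifts of
`w_a + D w_b` iff its coordinates `u · w_a` and `u · w_b` satisfy `u · w_b = -D (u · w_a)`. So the
Euclidean dual is generated by the rows `w'_a - D w'_b` for these pairs, together with the rows
`w'_c` for the unused exponents `c` (`rowModule_checkPencil`). In particular `H₁(D)` has the same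
number of rows of degree one as `G₁(D)`, which determines the degree of the quantum code.

All matrices involved are basic, with a matrix of leading row coefficients of full rank. Such a
matrix is reduced basic by the predictable degree property (`IsRowReduced.isReducedBasic`), and the
property passes to submatrices of rows and to CSS block matrices.

For the distances, let `G₁(D)` use the exponents `0, …, m - 1`. A phase-shift error that commutes
with the rows `w'_c`, `c ≥ m`, has all its coefficients in the span of `w_0, …, w_{m-1}`, so a
nonzero coefficient is the evaluation vector of a polynomial of degree less than `m` and has weight at least
`n - m + 1`. Let `G₂(D)` have the rows `w_0 + D w_t, w_1, …, w_{t-1}`. The highest coefficient of an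
undetectable qudit-flip error is orthogonal to `w_0, …, w_{t-1}`, so it has weight at least `t + 1`
by the BCH bound. If there is another nonzero coefficient, the total weight is at least `t + 2`;
otherwise the single coefficient is also orthogonal to `w_t`, with the same conclusion.
-/

namespace AQCC

open Matrix

/-! ### Row-reduced generator matrices -/

section RowReduced

variable {F : Type*} [Field F] {ι κ : Type*}

/-- `G(D)` is basic and row-reduced with row degrees `ν`: the entries of row `r` have degree at most
`ν r`, and the matrix of the coefficients of `D ^ ν r` has full row rank, expressed by a right
inverse. -/
structure IsRowReduced [Fintype κ] [DecidableEq ι] (G : Matrix ι κ F[X]) (ν : ι → ℕ) : Prop where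
  basic : IsBasic G
  natDegree_le : ∀ r j, (G r j).natDegree ≤ ν r
  lead : ∃ R : Matrix κ ι F, (Matrix.of fun r j => (G r j).coeff (ν r)) * R = 1

theorem natDegree_le_rowDegree [Fintype κ] (G : Matrix ι κ F[X]) (r : ι) (j : κ) :
    (G r j).natDegree ≤ rowDegree G r :=
  Finset.le_sup (f := fun j : κ => (G r j).natDegree) (Finset.mem_univ j)

open Classical in
/-- The predictable degree property: a combination that involves row `s` has an entry of degree at
least `ν s`, because the leading coefficient vectors cannot cancel. -/
theorem IsRowReduced.exists_le_natDegree [Fintype ι] [Fintype κ] [DecidableEq ι]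
    {G : Matrix ι κ F[X]} {ν : ι → ℕ} (hG : IsRowReduced G ν)
    (u : ι → F[X]) {s : ι} (hs : u s ≠ 0) : ∃ j, ν s ≤ ((u ᵥ* G) j).natDegree := by
  obtain ⟨R, hR⟩ := hG.lead
  obtain ⟨s₀, hs₀, hmax⟩ := Finset.exists_max_image (Finset.univ.filter fun s => u s ≠ 0)
    (fun s => (u s).natDegree + ν s) ⟨s, by simpa using hs⟩
  simp only [Finset.mem_filter, Finset.mem_univ, true_and] at hs₀ hmax
  set d := (u s₀).natDegree + ν s₀ with hd
  let c : ι → F := fun r => if ν r ≤ d then (u r).coeff (d - ν r) else 0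
  have hcoeff : ∀ j, ((u ᵥ* G) j).coeff d
      = (c ᵥ* (Matrix.of fun r j => (G r j).coeff (ν r))) j := by
    intro j
    simp only [vecMul, dotProduct, finsetSum_coeff, Matrix.of_apply, c]
    refine Finset.sum_congr rfl fun r _ => ?_
    by_cases hr : u r = 0
    · simp [hr]
    have hle := hmax r hr
    rw [if_pos (by omega)]
    conv_lhs => rw [show d = (d - ν r) + ν r by omega]
    exact coeff_mul_add_eq_of_natDegree_le (by omega) (hG.natDegree_le r j)
  have hc : c ≠ 0 := by
    intro h
    have := congrFun h s₀
    simp only [c, hd, Nat.le_add_left, if_true, Nat.add_sub_cancel, Pi.zero_apply,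
      coeff_natDegree, leadingCoeff_eq_zero] at this
    exact hs₀ this
  have hne : c ᵥ* (Matrix.of fun r j => (G r j).coeff (ν r)) ≠ 0 := by
    intro h
    apply hc
    have := congrArg (fun v => v ᵥ* R) h
    simpa [hR] using this
  obtain ⟨j, hj⟩ := Function.ne_iff.1 hne
  refine ⟨j, (hmax s hs).trans' (Nat.le_add_left _ _) |>.trans (le_natDegree_of_ne_zero ?_)⟩
  rw [hcoeff]
  exact hj

theorem IsRowReduced.rowDegree_eq [Fintype ι] [Fintype κ] [DecidableEq ι]
    {G : Matrix ι κ F[X]} {ν : ι → ℕ} (hG : IsRowReduced G ν)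
    (r : ι) : rowDegree G r = ν r := by
  apply le_antisymm (Finset.sup_le fun j _ => hG.natDegree_le r j)
  obtain ⟨j, hj⟩ := hG.exists_le_natDegree (Pi.single r 1) (s := r) (by simp)
  rw [single_one_vecMul] at hj
  exact hj.trans (natDegree_le_rowDegree G r j)

theorem IsRowReduced.overallConstraintLength_eq [Fintype ι] [Fintype κ] [DecidableEq ι]
    {G : Matrix ι κ F[X]} {ν : ι → ℕ} (hG : IsRowReduced G ν) :
    overallConstraintLength G = ∑ r, ν r :=
  Finset.sum_congr rfl fun r _ => hG.rowDegree_eq r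

theorem exists_eq_mul_of_rowModule_le [Fintype ι] {G G' : Matrix ι κ F[X]}
    (h : rowModule G' ≤ rowModule G) : ∃ T : Matrix ι ι F[X], G' = T * G := by
  have h1 : ∀ r, ∃ c : ι → F[X], ∑ i, c i • G i = G' r := fun r =>
    (Submodule.mem_span_range_iff_exists_fun _).1 (h (Submodule.subset_span ⟨r, rfl⟩))
  choose T hT using h1
  refine ⟨Matrix.of T, ?_⟩
  ext1 r j
  rw [← hT r]
  simp [Matrix.mul_apply]

/-- Two basic generator matrices of a module differ by an invertible matrix `T`. A nonzero term of
`det T` matches the rows, and the predictable degree property compares matched rows. -/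
theorem IsRowReduced.isReducedBasic [Fintype ι] [Fintype κ] [DecidableEq ι]
    {G : Matrix ι κ F[X]} {ν : ι → ℕ} (hG : IsRowReduced G ν) :
    IsReducedBasic G := by
  refine ⟨hG.basic, fun G' _ hmod => ?_⟩
  obtain ⟨T, hT⟩ := exists_eq_mul_of_rowModule_le hmod.le
  obtain ⟨T', hT'⟩ := exists_eq_mul_of_rowModule_le hmod.ge
  obtain ⟨R, hR⟩ := hG.basic
  have h1 : T' * T = 1 := by
    calc T' * T = T' * T * (G * R) := by rw [hR, Matrix.mul_one]
      _ = T' * (T * G) * R := by simp only [Matrix.mul_assoc]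
      _ = 1 := by rw [← hT, ← hT', hR]
  have hdet : T.det ≠ 0 := by
    intro h0
    have := congrArg Matrix.det h1
    simp [Matrix.det_mul, h0] at this
  have hex : ∃ σ : Equiv.Perm ι, ∀ i, T (σ i) i ≠ 0 := by
    by_contra! hcon
    apply hdet
    rw [Matrix.det_apply]
    refine Finset.sum_eq_zero fun σ _ => ?_
    obtain ⟨i, hi⟩ := hcon σ
    have h0 : ∏ i, T (σ i) i = 0 := Finset.prod_eq_zero (Finset.mem_univ i) hi
    exact (congrArg _ h0).trans (smul_zero _)
  obtain ⟨σ, hσ⟩ := hex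
  rw [hG.overallConstraintLength_eq, overallConstraintLength,
    ← Equiv.sum_comp σ (fun r => rowDegree G' r)]
  refine Finset.sum_le_sum fun i _ => ?_
  obtain ⟨j, hj⟩ := hG.exists_le_natDegree (T (σ i)) (hσ i)
  refine hj.trans ?_
  have : (T (σ i) ᵥ* G) j = G' (σ i) j := by rw [hT]; rfl
  rw [this]
  exact natDegree_le_rowDegree G' (σ i) j

theorem IsRowReduced.submatrix {ι' : Type*} [Fintype κ] [DecidableEq ι] [DecidableEq ι']
    {G : Matrix ι κ F[X]} {ν : ι → ℕ} (hG : IsRowReduced G ν) (f : ι' ↪ ι) :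
    IsRowReduced (G.submatrix f id) (ν ∘ f) := by
  obtain ⟨R, hR⟩ := hG.basic
  obtain ⟨L, hL⟩ := hG.lead
  refine ⟨⟨R.submatrix id f, ?_⟩, fun r j => hG.natDegree_le _ _, ⟨L.submatrix id f, ?_⟩⟩
  · rw [← Matrix.submatrix_mul _ _ _ _ _ Function.bijective_id, hR,
      Matrix.submatrix_one_embedding]
  · have := congrArg (fun M => M.submatrix f f) hL
    simp only [Matrix.submatrix_one_embedding] at this
    rw [← this, Matrix.submatrix_mul _ _ _ _ _ Function.bijective_id]
    rfl

theorem IsRowReduced.cssMatrix {n : ℕ} {ι' : Type*} [DecidableEq ι] [DecidableEq ι']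
    {G : Matrix ι (Fin n) F[X]} {ν : ι → ℕ} {G' : Matrix ι' (Fin n) F[X]} {ν' : ι' → ℕ}
    (hG : IsRowReduced G ν) (hG' : IsRowReduced G' ν') :
    IsRowReduced (AQCC.cssMatrix G G') (Sum.elim ν ν') := by
  obtain ⟨R, hR⟩ := hG.basic
  obtain ⟨L, hL⟩ := hG.lead
  obtain ⟨R', hR'⟩ := hG'.basic
  obtain ⟨L', hL'⟩ := hG'.lead
  refine ⟨⟨fromBlocks R 0 0 R', ?_⟩, ?_, ⟨fromBlocks L 0 0 L', ?_⟩⟩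
  · simp [AQCC.cssMatrix, fromBlocks_multiply, hR, hR']
  · rintro (r | r) (j | j) <;> simp [AQCC.cssMatrix, hG.natDegree_le, hG'.natDegree_le]
  · have : (Matrix.of fun r j => (AQCC.cssMatrix G G' r j).coeff (Sum.elim ν ν' r))
        = fromBlocks (Matrix.of fun r j => (G r j).coeff (ν r)) 0 0
          (Matrix.of fun r j => (G' r j).coeff (ν' r)) := by
      ext (r | r) (j | j) <;> simp [AQCC.cssMatrix]
    rw [this, fromBlocks_multiply, hL, hL']
    simp

end RowReduced

/-! ### Dual frames and matchings -/

section Frame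

variable {R : Type*} [CommRing R] {ι κ η : Type*} [Fintype ι] [Fintype κ]

/-- The rows of `A` and `B` together form a basis of `R ^ η`, and the columns of `A'` and `B'` form
the dual basis. -/
structure IsDualFrame [Fintype η] [DecidableEq ι] [DecidableEq κ] [DecidableEq η]
    (A : Matrix ι η R) (B : Matrix κ η R) (A' : Matrix η ι R)
    (B' : Matrix η κ R) : Prop where
  aa : A * A' = 1
  ab : A * B' = 0
  ba : B * A' = 0
  bb : B * B' = 1
  sum : A' * A + B' * B = 1

variable {A : Matrix ι η R} {B : Matrix κ η R} {A' : Matrix η ι R} {B' : Matrix η κ R}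

theorem transpose_mul_self_sq {P : Matrix ι κ R} (hP : P * Pᵀ * P = P) :
    Pᵀ * P * (Pᵀ * P) = Pᵀ * P := by
  rw [Matrix.mul_assoc, ← Matrix.mul_assoc P, hP]

theorem transpose_mul_mul_transpose {P : Matrix ι κ R} (hP : P * Pᵀ * P = P) :
    Pᵀ * P * Pᵀ = Pᵀ := by
  have := congrArg Matrix.transpose hP
  simpa [Matrix.transpose_mul, Matrix.mul_assoc] using this

section

variable [Fintype η] [DecidableEq ι] [DecidableEq κ] [DecidableEq η]

theorem IsDualFrame.map {S : Type*} [CommRing S] (h : IsDualFrame A B A' B') (φ : R →+* S) :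
    IsDualFrame (A.map φ) (B.map φ) (A'.map φ) (B'.map φ) := by
  constructor
  · rw [← Matrix.map_mul, h.aa, Matrix.map_one _ φ.map_zero φ.map_one]
  · rw [← Matrix.map_mul, h.ab, Matrix.map_zero _ φ.map_zero]
  · rw [← Matrix.map_mul, h.ba, Matrix.map_zero _ φ.map_zero]
  · rw [← Matrix.map_mul, h.bb, Matrix.map_one _ φ.map_zero φ.map_one]
  · rw [← Matrix.map_mul, ← Matrix.map_mul, ← Matrix.map_add _ φ.map_add, h.sum,
      Matrix.map_one _ φ.map_zero φ.map_one]

theorem IsDualFrame.transpose (h : IsDualFrame A B A' B') :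
    A'ᵀ * Aᵀ = 1 ∧ B'ᵀ * Aᵀ = 0 ∧ A'ᵀ * Bᵀ = 0 ∧ B'ᵀ * Bᵀ = 1 ∧ Aᵀ * A'ᵀ + Bᵀ * B'ᵀ = 1 := by
  refine ⟨?_, ?_, ?_, ?_, ?_⟩
  · rw [← transpose_mul, h.aa, transpose_one]
  · rw [← transpose_mul, h.ab, transpose_zero]
  · rw [← transpose_mul, h.ba, transpose_zero]
  · rw [← transpose_mul, h.bb, transpose_one]
  · rw [← transpose_mul, ← transpose_mul, ← transpose_add, h.sum, transpose_one]

theorem IsDualFrame.add_smul_mul (h : IsDualFrame A B A' B') (P : Matrix ι κ R) (x : R) :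
    (A + x • (P * B)) * A' = 1 := by
  rw [Matrix.add_mul, Matrix.smul_mul, Matrix.mul_assoc, h.aa, h.ba]
  simp

/-- The parity check matrix of the code with generator matrix `A + x⁻¹ P B`, in terms of the dual
frame. In the Euclidean dual of a convolutional code the generator matrix is evaluated at `1/D`, so
`x = D` belongs to the generator matrix `A + D P B`. For a partial permutation matrix `P` (so that
`P * Pᵀ * P = P`) its rows are the rows of `B'ᵀ` outside the matching and `A'ᵀ r - x B'ᵀ s` for each
matched pair `(r, s)`. -/
def checkMatrix (A' : Matrix η ι R) (B' : Matrix η κ R) (P : Matrix ι κ R) (x : R) :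
    Matrix κ η R :=
  (Pᵀ * A'ᵀ + (1 - Pᵀ * P) * B'ᵀ) + x • (-(Pᵀ * P * B'ᵀ))

/-- A right inverse of `checkMatrix`. -/
def checkMatrixInv (A : Matrix ι η R) (B : Matrix κ η R) (P : Matrix ι κ R) : Matrix η κ R :=
  Aᵀ * P + Bᵀ * (1 - Pᵀ * P)

theorem checkMatrix_mul_transpose_left (h : IsDualFrame A B A' B') (P : Matrix ι κ R) (x : R) :
    checkMatrix A' B' P x * Aᵀ = Pᵀ := by
  obtain ⟨h1, h2, -, -, -⟩ := h.transpose
  simp [checkMatrix, Matrix.add_mul, Matrix.mul_assoc, h1, h2]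

theorem checkMatrix_mul_transpose_right (h : IsDualFrame A B A' B') (P : Matrix ι κ R) (x : R) :
    checkMatrix A' B' P x * Bᵀ = (1 - Pᵀ * P) - x • (Pᵀ * P) := by
  obtain ⟨-, -, h3, h4, -⟩ := h.transpose
  simp [checkMatrix, Matrix.add_mul, Matrix.mul_assoc, h3, h4, sub_eq_add_neg]

theorem checkMatrix_mul_inv (h : IsDualFrame A B A' B') {P : Matrix ι κ R}
    (hP : P * Pᵀ * P = P) (x : R) :
    checkMatrix A' B' P x * checkMatrixInv A B P = 1 := by
  rw [checkMatrixInv, Matrix.mul_add, ← Matrix.mul_assoc, ← Matrix.mul_assoc,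
    checkMatrix_mul_transpose_left h, checkMatrix_mul_transpose_right h]
  have := transpose_mul_self_sq hP
  simp [Matrix.mul_sub, Matrix.sub_mul, this]

/-- Rows of `checkMatrix` are orthogonal to rows of `A + x⁻¹ P B`, multiplied by `x` here to avoid
the inverse. -/
theorem checkMatrix_orthogonal (h : IsDualFrame A B A' B') {P : Matrix ι κ R}
    (hP : P * Pᵀ * P = P) (x : R) :
    x • (checkMatrix A' B' P x * Aᵀ) + checkMatrix A' B' P x * (P * B)ᵀ = 0 := by
  rw [transpose_mul, ← Matrix.mul_assoc, checkMatrix_mul_transpose_left h,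
    checkMatrix_mul_transpose_right h]
  have := transpose_mul_mul_transpose hP
  simp [Matrix.sub_mul, this]

/-- Every vector orthogonal to the rows of `A + x⁻¹ P B` is a combination of the rows of
`checkMatrix`; stated for the rows of a matrix `u`. -/
theorem eq_mul_checkMatrix [IsDomain R] (h : IsDualFrame A B A' B') {P : Matrix ι κ R}
    (hP : P * Pᵀ * P = P) {x : R} (hx : x ≠ 0) {τ : Type*} (u : Matrix τ η R)
    (hu : x • (u * Aᵀ) + u * (P * B)ᵀ = 0) :
    u = u * checkMatrixInv A B P * checkMatrix A' B' P x := by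
  obtain ⟨-, -, -, -, h5⟩ := h.transpose
  have hq := transpose_mul_mul_transpose hP
  have hab : u = u * Aᵀ * A'ᵀ + u * Bᵀ * B'ᵀ := by
    rw [Matrix.mul_assoc, Matrix.mul_assoc, ← Matrix.mul_add, h5, Matrix.mul_one]
  rw [transpose_mul, ← Matrix.mul_assoc] at hu
  have hc : u * checkMatrixInv A B P = u * Aᵀ * P + u * Bᵀ * (1 - Pᵀ * P) := by
    simp only [checkMatrixInv, Matrix.mul_add, Matrix.mul_assoc]
  rw [hc]
  generalize u * Aᵀ = a at *
  generalize u * Bᵀ = b at *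
  have hb : b * Pᵀ = -(x • a) := by rw [eq_neg_iff_add_eq_zero, add_comm]; exact hu
  have ha : a * P * Pᵀ = a := by
    have h1 : x • (a * P * Pᵀ) = x • a := by
      have h2 : -(x • a) * P * Pᵀ = -(x • a) := by
        rw [← hb, Matrix.mul_assoc, Matrix.mul_assoc, ← Matrix.mul_assoc Pᵀ, hq]
      simpa using h2
    ext p r
    exact mul_left_cancel₀ hx (congrFun (congrFun h1 p) r)
  have hbp : b * (Pᵀ * P) = -(x • (a * P)) := by
    rw [← Matrix.mul_assoc, hb, Matrix.neg_mul, Matrix.smul_mul]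
  have hcp : (a * P + b * (1 - Pᵀ * P)) * Pᵀ = a := by
    rw [Matrix.add_mul, ha, Matrix.mul_assoc, Matrix.sub_mul, hq]
    simp
  have hcq : (a * P + b * (1 - Pᵀ * P)) * (Pᵀ * P) = a * P := by
    rw [← Matrix.mul_assoc, hcp]
  rw [checkMatrix, Matrix.mul_add, Matrix.mul_add, ← Matrix.mul_assoc, hcp, ← Matrix.mul_assoc,
    Matrix.mul_sub, hcq, Matrix.mul_smul, Matrix.mul_neg, ← Matrix.mul_assoc, hcq]
  conv_lhs => rw [hab]
  have : b * (1 - Pᵀ * P) = b + x • (a * P) := by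
    rw [Matrix.mul_sub, hbp, Matrix.mul_one, sub_neg_eq_add]
  rw [this]
  simp [Matrix.add_mul, add_assoc]

end

end Frame

/-! ### Orthogonality of polynomial vectors -/

section Shift

variable {F : Type*} [Field F] {ι κ : Type*}

/-- A matrix `Y + Z D` of memory at most one. -/
noncomputable def pencil (Y Z : Matrix ι κ F) : Matrix ι κ F[X] :=
  Y.map Polynomial.C + (X : F[X]) • Z.map Polynomial.C

theorem pencil_apply (Y Z : Matrix ι κ F) (r : ι) (j : κ) :
    pencil Y Z r j = Polynomial.C (Y r j) + X * Polynomial.C (Z r j) := rfl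

variable [Fintype κ]

theorem shiftProduct_comm (u v : κ → F[X]) :
    shiftProduct u v = invert (shiftProduct v u) := by
  simp only [shiftProduct, map_sum, map_mul]
  refine Finset.sum_congr rfl fun j _ => ?_
  rw [LaurentPolynomial.involutive_invert, mul_comm]

theorem shiftProduct_eq_zero_comm {u v : κ → F[X]} :
    shiftProduct u v = 0 ↔ shiftProduct v u = 0 := by
  rw [shiftProduct_comm u v, map_eq_zero_iff _ (AlgEquiv.injective _)]

@[simp]
theorem shiftProduct_zero_left (v : κ → F[X]) : shiftProduct 0 v = 0 := by simp [shiftProduct]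

@[simp]
theorem shiftProduct_zero_right (u : κ → F[X]) : shiftProduct u 0 = 0 := by simp [shiftProduct]

theorem mem_euclideanDual_rowModule {G : Matrix ι κ F[X]} {u : κ → F[X]} :
    u ∈ euclideanDual (rowModule G) ↔ ∀ r, shiftProduct u (G r) = 0 := by
  refine ⟨fun h r => h _ (Submodule.subset_span ⟨r, rfl⟩), fun h v hv => ?_⟩
  induction hv using Submodule.span_induction with
  | mem v hv => obtain ⟨r, rfl⟩ := hv; exact h r
  | zero => simp
  | add a b _ _ ha hb =>
    rw [shiftProduct] at ha hb
    simp [shiftProduct, mul_add, Finset.sum_add_distrib, ha, hb]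
  | smul c a _ ha =>
    rw [shiftProduct] at ha
    simp [shiftProduct, mul_left_comm, ← Finset.mul_sum, ha]

theorem shiftProduct_pencil (u : κ → F[X]) (Y Z : Matrix ι κ F) (r : ι) :
    shiftProduct u (pencil Y Z r) = toLaurent (∑ j, u j * Polynomial.C (Y r j)) +
      T (-1) * toLaurent (∑ j, u j * Polynomial.C (Z r j)) := by
  simp only [shiftProduct, pencil_apply, map_sum, map_add, map_mul, Polynomial.toLaurent_C,
    Polynomial.toLaurent_X, invert_C, invert_T, Finset.mul_sum, ← Finset.sum_add_distrib]
  exact Finset.sum_congr rfl fun j _ => by ring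

theorem shiftProduct_pencil_eq_zero_iff {u : κ → F[X]} {Y Z : Matrix ι κ F} {r : ι} :
    shiftProduct u (pencil Y Z r) = 0 ↔
      X * ∑ j, u j * Polynomial.C (Y r j) + ∑ j, u j * Polynomial.C (Z r j) = 0 := by
  have hT : (T 1 : F[T;T⁻¹]) * T (-1) = 1 := by rw [← T_add]; simp
  rw [shiftProduct_pencil, ← Polynomial.toLaurent_inj, map_add, map_mul, Polynomial.toLaurent_X,
    map_zero]
  constructor
  · intro h
    have := congrArg (fun p => T 1 * p) h
    simpa only [mul_add, ← mul_assoc, hT, one_mul, mul_zero] using this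
  · intro h
    have := congrArg (fun p => T (-1) * p) h
    simpa only [mul_add, ← mul_assoc, mul_comm (T (-1) : F[T;T⁻¹]) (T 1), hT, one_mul, mul_zero]
      using this

theorem shiftProduct_pencil_const_eq_zero_iff {u : κ → F[X]} {Y Z : Matrix ι κ F} {r : ι}
    (hZ : ∀ j, Z r j = 0) :
    shiftProduct u (pencil Y Z r) = 0 ↔ ∑ j, u j * Polynomial.C (Y r j) = 0 := by
  rw [shiftProduct_pencil_eq_zero_iff]
  simp [hZ]

theorem isRowReduced_pencil [DecidableEq ι] {Y Z : Matrix ι κ F} {ν : ι → ℕ} {R : Matrix κ ι F}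
    (hν : ∀ r, ν r = 0 ∧ (∀ j, Z r j = 0) ∨ ν r = 1) (hbasic : IsBasic (pencil Y Z))
    (hR : (Matrix.of fun r j => if ν r = 0 then Y r j else Z r j) * R = 1) :
    IsRowReduced (pencil Y Z) ν := by
  refine ⟨hbasic, fun r j => ?_, R, ?_⟩
  · rcases hν r with ⟨h0, hZ⟩ | h1
    · simp [pencil_apply, hZ]
    · rw [h1, pencil_apply]
      exact natDegree_add_le_of_degree_le (by simp)
        (natDegree_mul_le.trans (by simp))
  · rw [← hR]
    congr 1
    ext r j
    rcases hν r with ⟨h0, hZ⟩ | h1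
    · simp [pencil_apply, h0]
    · simp [pencil_apply, h1, coeff_C]

end Shift

/-! ### Partial permutation matrices -/

section Matching

variable {ι κ : Type*} (M : ι → κ → Prop) [∀ r s, Decidable (M r s)] (R : Type*) [CommRing R]

/-- The zero-one matrix of a relation. -/
def relMatrix : Matrix ι κ R := Matrix.of fun r s => if M r s then 1 else 0

open Classical in
theorem relMatrix_mul_transpose [DecidableEq ι] [Fintype κ] (h1 : ∀ r s s', M r s → M r s' → s = s')
    (h2 : ∀ r r' s, M r s → M r' s → r = r') :
    relMatrix M R * (relMatrix M R)ᵀ = diagonal fun r => if ∃ s, M r s then (1 : R) else 0 := by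
  ext r r'
  rw [Matrix.mul_apply, diagonal_apply]
  simp only [relMatrix, transpose_apply, of_apply, mul_ite, mul_one, mul_zero]
  by_cases hr : ∃ s, M r s
  · obtain ⟨s, hs⟩ := hr
    rw [Finset.sum_eq_single s]
    · by_cases hrr : r = r'
      · subst hrr
        simp only [hs, if_true]
        rw [if_pos ⟨s, hs⟩]
      · rw [if_neg fun h => hrr (h2 _ _ _ hs h), if_neg hrr]
    · intro s' _ hs'
      rw [if_neg (c := M r s') fun h => hs' (h1 _ _ _ h hs), ite_self]
    · simp
  · rw [Finset.sum_eq_zero, if_neg hr, ite_self]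
    intro s _
    rw [if_neg (c := M r s) fun h => hr ⟨s, h⟩, ite_self]

open Classical in
theorem transpose_mul_relMatrix [DecidableEq κ] [Fintype ι] (h1 : ∀ r s s', M r s → M r s' → s = s')
    (h2 : ∀ r r' s, M r s → M r' s → r = r') :
    (relMatrix M R)ᵀ * relMatrix M R = diagonal fun s => if ∃ r, M r s then (1 : R) else 0 :=
  relMatrix_mul_transpose (fun s r => M r s) R (fun s r r' => h2 r r' s) (fun s s' r => h1 r s s')

theorem relMatrix_mul_transpose_mul [Fintype ι] [Fintype κ]
    (h1 : ∀ r s s', M r s → M r s' → s = s') (h2 : ∀ r r' s, M r s → M r' s → r = r') :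
    relMatrix M R * (relMatrix M R)ᵀ * relMatrix M R = relMatrix M R := by
  classical
  rw [relMatrix_mul_transpose M R h1 h2]
  ext r s
  rw [diagonal_mul]
  by_cases h : M r s
  · rw [if_pos ⟨s, h⟩, one_mul]
  · simp [relMatrix, h]

end Matching

/-! ### A memory-one code and its dual -/

section Pair

variable {F : Type*} [Field F] {ι κ η : Type*} [Fintype κ]
  {A : Matrix ι η F} {B : Matrix κ η F} {A' : Matrix η ι F} {B' : Matrix η κ F}

theorem pencil_mul_eq_add_smul (A : Matrix ι η F) (B : Matrix κ η F) (P : Matrix ι κ F) :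
    pencil A (P * B) =
      A.map Polynomial.C + (X : F[X]) • (P.map Polynomial.C * B.map Polynomial.C) := by
  rw [pencil, Matrix.map_mul]

/-- The matrix `checkMatrix` over `F[D]` at `x = D`, for frames and matchings over `F`. -/
noncomputable def checkPencil [Fintype ι] [DecidableEq κ] (A' : Matrix η ι F)
    (B' : Matrix η κ F) (P : Matrix ι κ F) : Matrix κ η F[X] :=
  pencil (Pᵀ * A'ᵀ + (1 - Pᵀ * P) * B'ᵀ) (-(Pᵀ * P * B'ᵀ))

theorem checkPencil_eq [Fintype ι] [DecidableEq κ] (A' : Matrix η ι F) (B' : Matrix η κ F)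
    (P : Matrix ι κ F) : checkPencil A' B' P =
      checkMatrix (A'.map Polynomial.C) (B'.map Polynomial.C) (P.map Polynomial.C) (X : F[X]) := by
  have hC : ∀ a b : F, Polynomial.C (a - b) = Polynomial.C a - Polynomial.C b :=
    fun a b => (Polynomial.C (R := F)).map_sub a b
  have hn : ∀ M : Matrix κ η F, (-M).map (Polynomial.C : F →+* F[X]) = -(M.map Polynomial.C) := by
    intro M; ext1 i j; simp
  rw [checkPencil, pencil, checkMatrix, hn]
  simp only [Matrix.map_add _ (Polynomial.C (R := F)).map_add, Matrix.map_mul, Matrix.map_sub _ hC,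
    Matrix.map_one _ (Polynomial.C (R := F)).map_zero (Polynomial.C (R := F)).map_one,
    Matrix.transpose_map]

theorem map_C_partial [Fintype ι] {P : Matrix ι κ F} (hP : P * Pᵀ * P = P) :
    (P.map Polynomial.C * (P.map Polynomial.C)ᵀ * P.map Polynomial.C : Matrix ι κ F[X]) =
      P.map Polynomial.C := by
  conv_rhs => rw [← hP]
  simp only [Matrix.map_mul, Matrix.transpose_map]

theorem shiftProduct_pencil_mul_eq_zero_iff [Fintype η] {τ : Type*} (u : Matrix τ η F[X])
    (P : Matrix ι κ F) :
    (∀ p r, shiftProduct (u p) (pencil A (P * B) r) = 0) ↔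
      (X : F[X]) • (u * (A.map Polynomial.C)ᵀ) +
        u * (P.map Polynomial.C * B.map Polynomial.C)ᵀ = 0 := by
  rw [← Matrix.ext_iff]
  refine forall_congr' fun p => forall_congr' fun r => ?_
  rw [shiftProduct_pencil_eq_zero_iff, ← Matrix.map_mul]
  rfl

variable [Fintype ι] [Fintype η] [DecidableEq ι] [DecidableEq κ] [DecidableEq η]

theorem pencil_mul_map (h : IsDualFrame A B A' B') (P : Matrix ι κ F) :
    pencil A (P * B) * A'.map Polynomial.C = 1 := by
  rw [pencil_mul_eq_add_smul]
  exact (h.map Polynomial.C).add_smul_mul _ _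

theorem isBasic_checkPencil (h : IsDualFrame A B A' B') {P : Matrix ι κ F}
    (hP : P * Pᵀ * P = P) : IsBasic (checkPencil A' B' P) := by
  rw [checkPencil_eq]
  exact ⟨_, checkMatrix_mul_inv (h.map Polynomial.C) (map_C_partial hP) X⟩

/-- The Euclidean dual of the code generated by `A + D P B` is generated by `checkPencil`. -/
theorem rowModule_checkPencil (h : IsDualFrame A B A' B') {P : Matrix ι κ F}
    (hP : P * Pᵀ * P = P) :
    rowModule (checkPencil A' B' P) = euclideanDual (rowModule (pencil A (P * B))) := by
  have hP' := map_C_partial hP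
  apply le_antisymm
  · refine Submodule.span_le.2 ?_
    rintro _ ⟨s, rfl⟩
    refine mem_euclideanDual_rowModule.2 ?_
    refine (shiftProduct_pencil_mul_eq_zero_iff (checkPencil A' B' P) P).2 ?_ s
    rw [checkPencil_eq]
    exact checkMatrix_orthogonal (h.map Polynomial.C) hP' X
  · intro u hu
    have hu' := (shiftProduct_pencil_mul_eq_zero_iff (A := A) (B := B)
      (Matrix.of fun _ : Unit => u) P).1 fun _ r => mem_euclideanDual_rowModule.1 hu r
    have hmul := eq_mul_checkMatrix (h.map Polynomial.C) hP' X_ne_zero _ hu'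
    rw [← checkPencil_eq] at hmul
    refine (Submodule.mem_span_range_iff_exists_fun _).2
      ⟨((Matrix.of fun _ : Unit => u) * checkMatrixInv (A.map Polynomial.C) (B.map Polynomial.C)
        (P.map Polynomial.C)) (), ?_⟩
    ext1 j
    conv_rhs => rw [show u j = (Matrix.of fun _ : Unit => u) () j from rfl, hmul]
    rw [Matrix.mul_apply]
    simp

variable (M : ι → κ → Prop) [∀ r s, Decidable (M r s)]

open Classical in
theorem isRowReduced_pencil_relMatrix (h : IsDualFrame A B A' B')
    (h1 : ∀ r s s', M r s → M r s' → s = s') (h2 : ∀ r r' s, M r s → M r' s → r = r') :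
    IsRowReduced (pencil A (relMatrix M F * B)) fun r => if ∃ s, M r s then 1 else 0 := by
  set P := relMatrix M F with hPdef
  have hd := relMatrix_mul_transpose M F h1 h2
  have hP := relMatrix_mul_transpose_mul M F h1 h2
  rw [← hPdef] at hd hP
  have hrow : ∀ r, (¬ ∃ s, M r s) → ∀ j, (P * B) r j = 0 := by
    intro r hr j
    rw [Matrix.mul_apply]
    refine Finset.sum_eq_zero fun s _ => ?_
    have : ¬ M r s := fun hs => hr ⟨s, hs⟩
    simp [hPdef, relMatrix, this]
  refine isRowReduced_pencil (R := A' * (1 - P * Pᵀ) + B' * Pᵀ) (fun r => ?_)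
    ⟨_, pencil_mul_map h P⟩ ?_
  · by_cases hr : ∃ s, M r s
    · right; rw [if_pos hr]
    · left; exact ⟨if_neg hr, hrow r hr⟩
  · have hL : (Matrix.of fun r j => if (if ∃ s, M r s then 1 else 0) = 0 then A r j
        else (P * B) r j) = (1 - P * Pᵀ) * A + P * B := by
      ext1 r j
      rw [hd, Matrix.sub_mul, Matrix.one_mul, Matrix.add_apply, Matrix.sub_apply, diagonal_mul]
      by_cases hr : ∃ s, M r s
      · simp [hr]
      · simp [hr, hrow r hr j]
    have hPP : P * Pᵀ * (P * Pᵀ) = P * Pᵀ := by rw [← Matrix.mul_assoc, hP]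
    rw [hL, Matrix.add_mul, Matrix.mul_add, Matrix.mul_add, Matrix.mul_assoc, Matrix.mul_assoc,
      Matrix.mul_assoc, Matrix.mul_assoc, ← Matrix.mul_assoc A, ← Matrix.mul_assoc A,
      ← Matrix.mul_assoc B, ← Matrix.mul_assoc B, h.aa, h.ab, h.ba, h.bb]
    simp [Matrix.mul_sub, Matrix.sub_mul, hPP]

open Classical in
theorem isRowReduced_checkPencil (h : IsDualFrame A B A' B')
    (h1 : ∀ r s s', M r s → M r s' → s = s') (h2 : ∀ r r' s, M r s → M r' s → r = r') :
    IsRowReduced (checkPencil A' B' (relMatrix M F)) fun s => if ∃ r, M r s then 1 else 0 := by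
  set P := relMatrix M F with hPdef
  have hd := transpose_mul_relMatrix M F h1 h2
  have hP := relMatrix_mul_transpose_mul M F h1 h2
  rw [← hPdef] at hd hP
  obtain ⟨-, -, -, hbb, -⟩ := h.transpose
  refine isRowReduced_pencil (R := Bᵀ * (1 - Pᵀ * P - Pᵀ * P)) (fun s => ?_)
    (isBasic_checkPencil h hP) ?_
  · by_cases hs : ∃ r, M r s
    · right; rw [if_pos hs]
    · left
      refine ⟨if_neg hs, fun j => ?_⟩
      rw [hd, Matrix.neg_apply, diagonal_mul, if_neg hs]
      simp
  · have hL : (Matrix.of fun s j => if (if ∃ r, M r s then 1 else 0) = 0 then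
        (Pᵀ * A'ᵀ + (1 - Pᵀ * P) * B'ᵀ : Matrix κ η F) s j else
          (-(Pᵀ * P * B'ᵀ) : Matrix κ η F) s j)
        = (1 - Pᵀ * P - Pᵀ * P) * B'ᵀ := by
      ext1 s j
      simp only [hd, Matrix.sub_mul, Matrix.one_mul, Matrix.sub_apply, Matrix.add_apply,
        Matrix.neg_apply, Matrix.of_apply, diagonal_mul]
      by_cases hs : ∃ r, M r s
      · simp [hs]
      · have h0 : (Pᵀ * A'ᵀ) s j = 0 := by
          rw [Matrix.mul_apply]
          refine Finset.sum_eq_zero fun r _ => ?_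
          have : ¬ M r s := fun hr => hs ⟨r, hr⟩
          simp [hPdef, relMatrix, this]
        simp [hs, h0]
    have hq := transpose_mul_self_sq hP
    rw [hL, Matrix.mul_assoc, ← Matrix.mul_assoc B'ᵀ, hbb]
    simp [Matrix.mul_sub, Matrix.sub_mul, hq]

end Pair

/-! ### Weights -/

section Weight

variable {F : Type*} [Field F] [DecidableEq F]

theorem sum_card_coeff_le_weight {κ : Type*} [Fintype κ] (x : κ → F[X]) (E : Finset ℕ) :
    ∑ d ∈ E, (Finset.univ.filter fun j => (x j).coeff d ≠ 0).card ≤ weight x := by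
  simp only [weight, Finset.card_filter]
  rw [Finset.sum_comm]
  refine Finset.sum_le_sum fun j _ => ?_
  rw [← Finset.card_filter]
  exact Finset.card_le_card fun d hd => by simpa using (Finset.mem_filter.1 hd).2

/-- The BCH bound for exponents `0, …, d - 1`, where `a j` are distinct elements. A polynomial of
degree less than `d` can isolate one position of a support of at most `d` elements. -/
theorem lt_card_of_forall_sum_mul_pow {κ : Type*} [Fintype κ] {a : κ → F}
    (ha : Function.Injective a) {y : κ → F} (hy : y ≠ 0) {d : ℕ}
    (h : ∀ c < d, ∑ j, y j * a j ^ c = 0) :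
    d < (Finset.univ.filter fun j => y j ≠ 0).card := by
  classical
  by_contra! hle
  obtain ⟨j₀, hj₀⟩ := Function.ne_iff.1 hy
  have hmem : j₀ ∈ Finset.univ.filter fun j => y j ≠ 0 := by simpa using hj₀
  have hcard := Finset.card_erase_add_one hmem
  set S := (Finset.univ.filter fun j => y j ≠ 0).erase j₀ with hS
  have hcard : S.card < d := by
    omega
  set p : F[X] := ∏ k ∈ S, (X - Polynomial.C (a k)) with hp
  have hdeg : p.natDegree < d := by rwa [hp, natDegree_prod_of_monic _ _ fun k _ => monic_X_sub_C _,
    Finset.sum_congr rfl fun k _ => natDegree_X_sub_C (a k), Finset.sum_const, smul_eq_mul, mul_one]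
  have hsum : ∑ j, y j * p.eval (a j) = 0 := by
    simp only [eval_eq_sum_range' hdeg, Finset.mul_sum]
    rw [Finset.sum_comm]
    refine Finset.sum_eq_zero fun c hc => ?_
    rw [← mul_zero (p.coeff c), ← h c (Finset.mem_range.1 hc), Finset.mul_sum]
    exact Finset.sum_congr rfl fun j _ => by ring
  rw [Finset.sum_eq_single j₀] at hsum
  · refine mul_ne_zero hj₀ ?_ hsum
    rw [hp, eval_prod, Finset.prod_ne_zero_iff]
    intro k hk
    simpa [sub_eq_zero] using fun hh => (Finset.mem_erase.1 hk).1 (ha hh).symm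
  · intro j _ hj
    by_cases hyj : y j = 0
    · simp [hyj]
    · have : j ∈ S := by simp [hS, hj, hyj]
      rw [hp, eval_prod, Finset.prod_eq_zero this (by simp), mul_zero]
  · simp

/-- A nonzero evaluation vector of a polynomial of degree less than `m` has fewer than `m` zeros. -/
theorem card_lt_card_add_of_eval {κ : Type*} [Fintype κ] {a : κ → F}
    (ha : Function.Injective a) {y : κ → F} (hy : y ≠ 0) {m : ℕ} (p : F[X])
    (hp : p.degree < m) (hyp : ∀ j, y j = p.eval (a j)) :
    Fintype.card κ < (Finset.univ.filter fun j => y j ≠ 0).card + m := by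
  have hp0 : p ≠ 0 := by
    rintro rfl
    exact hy (funext fun j => by simp [hyp])
  have h1 : (Finset.univ.filter fun j => y j = 0).card ≤ p.natDegree := by
    rw [← Finset.card_image_of_injective _ ha]
    refine card_le_degree_of_subset_roots fun x hx => ?_
    obtain ⟨j, hj, rfl⟩ := Finset.mem_image.1 hx
    rw [mem_roots hp0, IsRoot.def, ← hyp]
    exact (Finset.mem_filter.1 hj).2
  have h2 := Finset.card_filter_add_card_filter_not (s := (Finset.univ : Finset κ))
    (fun j => y j = 0)
  have h3 := (natDegree_lt_iff_degree_lt hp0).2 hp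
  rw [Finset.card_univ] at h2
  simp only [ne_eq]
  omega

end Weight

/-! ### Undetectable errors of a CSS code -/

section CSS

variable {F : Type*} [Field F] {n : ℕ} {ι ι' : Type*}
  {H : Matrix ι (Fin n) F[X]} {G : Matrix ι' (Fin n) F[X]}

theorem mem_rowModule_cssMatrix {e : Fin n ⊕ Fin n → F[X]} (he : e ∈ rowModule (cssMatrix H G)) :
    (fun j => e (Sum.inl j)) ∈ rowModule H ∧ (fun j => e (Sum.inr j)) ∈ rowModule G := by
  induction he using Submodule.span_induction with
  | mem v hv =>
    obtain ⟨r | r, rfl⟩ := hv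
    · exact ⟨Submodule.subset_span ⟨r, rfl⟩, Submodule.zero_mem _⟩
    · exact ⟨Submodule.zero_mem _, Submodule.subset_span ⟨r, rfl⟩⟩
  | zero => exact ⟨Submodule.zero_mem _, Submodule.zero_mem _⟩
  | add a b _ _ ha hb =>
    exact ⟨Submodule.add_mem _ ha.1 hb.1, Submodule.add_mem _ ha.2 hb.2⟩
  | smul c a _ ha => exact ⟨Submodule.smul_mem _ c ha.1, Submodule.smul_mem _ c ha.2⟩

theorem symplecticProduct_cssMatrix_inl (e : Fin n ⊕ Fin n → F[X]) (r : ι) :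
    symplecticProduct e (cssMatrix H G (Sum.inl r))
      = -shiftProduct (fun j => e (Sum.inr j)) (H r) := by
  rw [symplecticProduct]
  have : (fun j => cssMatrix H G (Sum.inl r) (Sum.inr j)) = 0 := rfl
  rw [this, shiftProduct_zero_right, zero_sub]
  rfl

theorem symplecticProduct_cssMatrix_inr (e : Fin n ⊕ Fin n → F[X]) (r : ι') :
    symplecticProduct e (cssMatrix H G (Sum.inr r))
      = shiftProduct (fun j => e (Sum.inl j)) (G r) := by
  rw [symplecticProduct]
  have : (fun j => cssMatrix H G (Sum.inr r) (Sum.inl j)) = 0 := rfl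
  rw [this, shiftProduct_zero_right, sub_zero]
  rfl

theorem undetectable_phase_of {z : Fin n → F[X]} (h : ∀ r, shiftProduct z (H r) = 0)
    (hz : z ∉ rowModule G) :
    (Sum.elim 0 z : Fin n ⊕ Fin n → F[X]) ∈ undetectable (cssMatrix H G) := by
  refine ⟨?_, fun hmem => hz (mem_rowModule_cssMatrix hmem).2⟩
  rintro (r | r)
  · rw [symplecticProduct_cssMatrix_inl, neg_eq_zero]
    exact h r
  · rw [symplecticProduct_cssMatrix_inr]
    exact shiftProduct_zero_left _

theorem undetectable_flip_of {x : Fin n → F[X]} (h : ∀ r, shiftProduct x (G r) = 0)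
    (hx : x ∉ rowModule H) :
    (Sum.elim x 0 : Fin n ⊕ Fin n → F[X]) ∈ undetectable (cssMatrix H G) := by
  refine ⟨?_, fun hmem => hx (mem_rowModule_cssMatrix hmem).1⟩
  rintro (r | r)
  · rw [symplecticProduct_cssMatrix_inl, neg_eq_zero]
    exact shiftProduct_zero_left _
  · rw [symplecticProduct_cssMatrix_inr]
    exact h r

theorem of_undetectable_phase {z : Fin n → F[X]}
    (h : (Sum.elim 0 z : Fin n ⊕ Fin n → F[X]) ∈ undetectable (cssMatrix H G)) :
    (∀ r, shiftProduct z (H r) = 0) ∧ z ≠ 0 := by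
  refine ⟨fun r => ?_, ?_⟩
  · have := h.1 (Sum.inl r)
    rwa [symplecticProduct_cssMatrix_inl, neg_eq_zero] at this
  · rintro rfl
    apply h.2
    rw [Sum.elim_zero_zero]
    exact Submodule.zero_mem _

theorem of_undetectable_flip {x : Fin n → F[X]}
    (h : (Sum.elim x 0 : Fin n ⊕ Fin n → F[X]) ∈ undetectable (cssMatrix H G)) :
    (∀ r, shiftProduct x (G r) = 0) ∧ x ≠ 0 := by
  refine ⟨fun r => ?_, ?_⟩
  · have := h.1 (Sum.inr r)
    rwa [symplecticProduct_cssMatrix_inr] at this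
  · rintro rfl
    apply h.2
    rw [Sum.elim_zero_zero]
    exact Submodule.zero_mem _

theorem cssMatrix_self_orthogonal (h : ∀ r s, shiftProduct (H r) (G s) = 0) (r s : ι ⊕ ι') :
    symplecticProduct (cssMatrix H G r) (cssMatrix H G s) = 0 := by
  rcases s with s | s
  · rw [symplecticProduct_cssMatrix_inl, neg_eq_zero]
    rcases r with r | r
    · exact shiftProduct_zero_left _
    · exact shiftProduct_eq_zero_comm.1 (h s r)
  · rw [symplecticProduct_cssMatrix_inr]
    rcases r with r | r
    · exact h r s
    · exact shiftProduct_zero_left _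

end CSS

/-! ### Entries of the generator matrices -/

section Entries

variable {F : Type*} [Field F] {ι κ η : Type*} [Fintype κ] (M : ι → κ → Prop)
  [∀ r s, Decidable (M r s)]

theorem relMatrix_mul_apply_of_rel (h1 : ∀ r s s', M r s → M r s' → s = s') (B : Matrix κ η F)
    {r : ι} {s : κ} (h : M r s) (j : η) : (relMatrix M F * B) r j = B s j := by
  rw [Matrix.mul_apply, Finset.sum_eq_single s]
  · simp [relMatrix, h]
  · intro s' _ hs'
    have : ¬ M r s' := fun h' => hs' (h1 _ _ _ h' h)
    simp [relMatrix, this]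
  · simp

theorem relMatrix_mul_apply_of_not (B : Matrix κ η F) {r : ι} (h : ∀ s, ¬ M r s) (j : η) :
    (relMatrix M F * B) r j = 0 := by
  rw [Matrix.mul_apply]
  refine Finset.sum_eq_zero fun s _ => ?_
  simp [relMatrix, h]

theorem checkPencil_apply_of_not [Fintype ι] [DecidableEq κ]
    (h1 : ∀ r s s', M r s → M r s' → s = s') (h2 : ∀ r r' s, M r s → M r' s → r = r')
    (A' : Matrix η ι F) (B' : Matrix η κ F) {s : κ} (h : ∀ r, ¬ M r s) (j : η) :
    checkPencil A' B' (relMatrix M F) s j = Polynomial.C (B' j s) := by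
  have h0 : ((relMatrix M F)ᵀ * A'ᵀ) s j = 0 := by
    rw [Matrix.mul_apply]
    refine Finset.sum_eq_zero fun r _ => ?_
    simp [relMatrix, h]
  rw [checkPencil, pencil_apply, transpose_mul_relMatrix M F h1 h2]
  simp [Matrix.sub_mul, h0, h]

end Entries

/-! ### Bounds on the free distances -/

section Bounds

variable {F : Type*} [Field F] {n : ℕ}

/-- The matrix with rows `(1, α ^ c, α ^ (2 c), …)` for `0 ≤ c < n`. -/
def powMatrix (α : F) (n : ℕ) : Matrix (Fin n) (Fin n) F :=
  Matrix.of fun c j => α ^ ((j : ℕ) * (c : ℕ))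

theorem isUnit_det_powMatrix {α : F} (hα : Function.Injective fun j : Fin n => α ^ (j : ℕ)) :
    IsUnit (powMatrix α n).det := by
  have : powMatrix α n = (vandermonde fun j : Fin n => α ^ (j : ℕ))ᵀ := by
    ext c j
    simp [powMatrix, vandermonde_apply, pow_mul]
  rw [this, det_transpose, isUnit_iff_ne_zero]
  exact det_vandermonde_ne_zero_iff.2 hα

theorem exists_coeff_ne_zero {x : Fin n → F[X]} (hx : x ≠ 0) :
    ∃ d, (fun j => (x j).coeff d) ≠ 0 := by
  by_contra! h
  exact hx (funext fun j => Polynomial.ext fun d => congrFun (h d) j)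

/-- If the coordinates of `z` outside the first `m` rows of `powMatrix α n` vanish, then each
coefficient of `z` is the evaluation vector of a polynomial of degree less than `m`. -/
theorem lt_weight_add_of_coordinates {α : F}
    (hα : Function.Injective fun j : Fin n => α ^ (j : ℕ)) {W' : Matrix (Fin n) (Fin n) F}
    (hW : W' * powMatrix α n = 1) {z : Fin n → F[X]} (hz : z ≠ 0) {m : ℕ}
    (hm : ∀ c : Fin n, m ≤ c → ∑ j, z j * Polynomial.C (W' j c) = 0) : n < weight z + m := by
  classical
  obtain ⟨d, hd⟩ := exists_coeff_ne_zero hz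
  set y : Fin n → F := fun j => (z j).coeff d with hy
  set a : Fin n → F := y ᵥ* W' with ha
  have ham : ∀ c : Fin n, m ≤ c → a c = 0 := by
    intro c hc
    have := congrArg (fun p => p.coeff d) (hm c hc)
    simp only [finsetSum_coeff, coeff_mul_C, coeff_zero] at this
    exact this
  have hya : y = a ᵥ* powMatrix α n := by rw [ha, vecMul_vecMul, hW, vecMul_one]
  set p : F[X] := ∑ c : Fin n, monomial (c : ℕ) (a c) with hp
  have hdeg : p.degree < m := by
    rw [← mem_degreeLT]
    refine Submodule.sum_mem _ fun c _ => mem_degreeLT.2 ?_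
    by_cases hc : m ≤ c
    · rw [ham c hc, monomial_zero_right, Polynomial.degree_zero]
      exact WithBot.bot_lt_coe m
    · exact (degree_monomial_le _ _).trans_lt (by exact_mod_cast not_le.1 hc)
  have heval : ∀ j, y j = p.eval (α ^ (j : ℕ)) := by
    intro j
    rw [hya, hp, eval_finsetSum]
    simp only [vecMul, dotProduct, powMatrix, of_apply, eval_monomial, pow_mul]
  have h1 := card_lt_card_add_of_eval hα hd p hdeg heval
  have h2 : (Finset.univ.filter fun j => y j ≠ 0).card ≤ weight z := by
    simpa only [Finset.sum_singleton] using sum_card_coeff_le_weight z {d}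
  rw [Fintype.card_fin] at h1
  omega

/-- The weight bound for the dual of a code with constant rows of exponents `1, …, t - 1` and one
row of exponent `0` plus `D` times exponent `t`. The highest coefficient of `x` has more than `t`
nonzero entries. Either there is another nonzero coefficient, or the only one is also
orthogonal to the row of exponent `t`. -/
theorem le_weight_of_orthogonal {α : F}
    (hα : Function.Injective fun j : Fin n => α ^ (j : ℕ)) {x : Fin n → F[X]} (hx : x ≠ 0) {t : ℕ}
    (h : ∀ c, 1 ≤ c → c < t → ∑ j, x j * Polynomial.C (α ^ ((j : ℕ) * c)) = 0)
    (h0 : X * ∑ j, x j * Polynomial.C (α ^ ((j : ℕ) * 0)) +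
      ∑ j, x j * Polynomial.C (α ^ ((j : ℕ) * t)) = 0) : t + 2 ≤ weight x := by
  classical
  set E := Finset.univ.sup fun j => (x j).natDegree with hE
  have hlarge : ∀ d, E < d → ∀ j, (x j).coeff d = 0 := fun d hd j =>
    coeff_eq_zero_of_natDegree_lt
      ((Finset.le_sup (f := fun j => (x j).natDegree) (Finset.mem_univ j)).trans_lt hd)
  have hcoeff : ∀ c d, (∑ j, x j * Polynomial.C (α ^ ((j : ℕ) * c))).coeff d
      = ∑ j, (x j).coeff d * (α ^ (j : ℕ)) ^ c := by
    intro c d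
    simp only [finsetSum_coeff, coeff_mul_C, pow_mul]
  have hE0 : (fun j => (x j).coeff E) ≠ 0 := by
    obtain ⟨d, hd⟩ := exists_coeff_ne_zero hx
    obtain ⟨j₁, hj₁⟩ := Function.ne_iff.1 hd
    obtain ⟨j, -, hj⟩ := Finset.exists_mem_eq_sup Finset.univ ⟨j₁, Finset.mem_univ _⟩
      (fun j => (x j).natDegree)
    intro hcon
    have h1 := congrFun hcon j
    simp only [Pi.zero_apply] at h1
    rw [hE, hj, coeff_natDegree, leadingCoeff_eq_zero] at h1
    have hEz : E = 0 := by rw [hE, hj, h1, natDegree_zero]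
    rcases Nat.eq_zero_or_pos d with rfl | hd0
    · exact hj₁ (by simpa [hEz] using congrFun hcon j₁)
    · exact hj₁ (hlarge d (by omega) j₁)
  -- Comparing coefficients of `D ^ (d + 1)` links exponent `0` at `d` to exponent `t` at `d + 1`.
  have hlink : ∀ d, ∑ j, (x j).coeff d * (α ^ (j : ℕ)) ^ 0
      + ∑ j, (x j).coeff (d + 1) * (α ^ (j : ℕ)) ^ t = 0 := by
    intro d
    have := congrArg (fun p => p.coeff (d + 1)) h0
    rwa [coeff_add, coeff_X_mul, hcoeff, hcoeff, coeff_zero] at this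
  have htop : ∀ c < t, ∑ j, (x j).coeff E * (α ^ (j : ℕ)) ^ c = 0 := by
    intro c hc
    rcases Nat.eq_zero_or_pos c with rfl | hc0
    · have := hlink E
      rwa [Finset.sum_eq_zero (s := Finset.univ)
        (f := fun j => (x j).coeff (E + 1) * (α ^ (j : ℕ)) ^ t), add_zero] at this
      intro j _
      rw [hlarge _ (Nat.lt_succ_self E), zero_mul]
    · rw [← hcoeff, h c hc0 hc, coeff_zero]
  have hcard := lt_card_of_forall_sum_mul_pow hα hE0 htop
  by_cases hother : ∃ d, d ≠ E ∧ (fun j => (x j).coeff d) ≠ 0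
  · obtain ⟨d, hdE, hd⟩ := hother
    have hw := sum_card_coeff_le_weight x {d, E}
    rw [Finset.sum_pair hdE] at hw
    obtain ⟨j, hj⟩ := Function.ne_iff.1 hd
    have : 0 < (Finset.univ.filter fun j => (x j).coeff d ≠ 0).card :=
      Finset.card_pos.2 ⟨j, by simpa using hj⟩
    omega
  · push Not at hother
    have ht : ∑ j, (x j).coeff E * (α ^ (j : ℕ)) ^ t = 0 := by
      rcases Nat.eq_zero_or_pos E with hE' | hE'
      · have := congrArg (fun p => p.coeff 0) h0
        rw [hE', ← hcoeff]
        simpa only [coeff_add, mul_coeff_zero, coeff_X_zero, zero_mul, zero_add, coeff_zero]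
          using this
      · have := hlink (E - 1)
        rw [Nat.sub_add_cancel hE'] at this
        rwa [Finset.sum_eq_zero (s := Finset.univ)
          (f := fun j => (x j).coeff (E - 1) * (α ^ (j : ℕ)) ^ 0), zero_add] at this
        intro j _
        rw [show (x j).coeff (E - 1) = 0 from congrFun (hother _ (by omega)) j, zero_mul]
    have hcard' := lt_card_of_forall_sum_mul_pow hα hE0 (d := t + 1) fun c hc => by
      rcases Nat.lt_succ_iff_lt_or_eq.1 hc with hc | rfl
      · exact htop c hc
      · exact ht
    have hw := sum_card_coeff_le_weight x {E}
    rw [Finset.sum_singleton] at hw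
    omega

end Bounds

/-! ### The code pairs -/

section Construction

/-- A reordering of the exponents: the rows of the generator matrix take all exponents up to `N`
except `t`, and the remaining ones start with `t`. -/
theorem exists_exponent_equiv {n N t : ℕ} (ht : t < N) (hn : N < n) :
    ∃ σ : Fin N ⊕ Fin (n - N) ≃ Fin n,
      (∀ r, (σ (Sum.inl r) : ℕ) = if (r : ℕ) < t then (r : ℕ) else r + 1) ∧
      ∀ s, (σ (Sum.inr s) : ℕ) = if (s : ℕ) = 0 then t else N + s := by
  let f : Fin N ⊕ Fin (n - N) → Fin n := Sum.elim
    (fun r => ⟨if (r : ℕ) < t then (r : ℕ) else r + 1, by split_ifs <;> omega⟩)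
    (fun s => ⟨if (s : ℕ) = 0 then t else N + s, by split_ifs <;> omega⟩)
  have hf : Function.Bijective f := by
    rw [Fintype.bijective_iff_injective_and_card]
    refine ⟨?_, by simp; omega⟩
    rintro (r | r) (s | s) h <;> simp only [f, Sum.elim_inl, Sum.elim_inr, Fin.mk.injEq] at h
    · congr 1; ext; split_ifs at h <;> omega
    · exfalso; split_ifs at h <;> omega
    · exfalso; split_ifs at h <;> omega
    · congr 1; ext; split_ifs at h <;> omega
  exact ⟨Equiv.ofBijective f hf, fun r => rfl, fun s => rfl⟩

theorem isDualFrame_submatrix {F : Type*} [Field F] {ι κ η : Type*} [Fintype ι] [Fintype κ]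
    [Fintype η] [DecidableEq ι] [DecidableEq κ] [DecidableEq η] {W W' : Matrix η η F}
    (h : W * W' = 1) (h' : W' * W = 1) (σ : ι ⊕ κ ≃ η) :
    IsDualFrame (W.submatrix (σ ∘ Sum.inl) id) (W.submatrix (σ ∘ Sum.inr) id)
      (W'.submatrix id (σ ∘ Sum.inl)) (W'.submatrix id (σ ∘ Sum.inr)) := by
  constructor
  · rw [← Matrix.submatrix_mul _ _ _ _ _ Function.bijective_id, h]
    ext r s
    simp [Matrix.one_apply]
  · rw [← Matrix.submatrix_mul _ _ _ _ _ Function.bijective_id, h]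
    ext r s
    simp
  · rw [← Matrix.submatrix_mul _ _ _ _ _ Function.bijective_id, h]
    ext r s
    simp
  · rw [← Matrix.submatrix_mul _ _ _ _ _ Function.bijective_id, h]
    ext r s
    simp [Matrix.one_apply]
  · rw [← h']
    ext j k
    simp only [Matrix.add_apply, Matrix.mul_apply, submatrix_apply, id, Function.comp]
    rw [← Equiv.sum_comp σ (fun c => W' j c * W c k), Fintype.sum_sum_type]

/-- The matching of generator rows with additional exponents: row `0` with the first one, and for
`e = 1` also row `t` with the second one. -/
def Matched (e t : ℕ) {a b : ℕ} (r : Fin a) (s : Fin b) : Prop :=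
  ((r : ℕ) = 0 ∧ (s : ℕ) = 0) ∨ (e = 1 ∧ (r : ℕ) = t ∧ (s : ℕ) = 1)

instance (e t : ℕ) {a b : ℕ} (r : Fin a) (s : Fin b) : Decidable (Matched e t r s) := by
  unfold Matched; infer_instance

theorem Matched.right_unique {e t a b : ℕ} (ht : 1 ≤ t) (r : Fin a) (s s' : Fin b)
    (h : Matched e t r s) (h' : Matched e t r s') : s = s' := by
  unfold Matched at h h'; ext; omega

theorem Matched.left_unique {e t a b : ℕ} (r r' : Fin a) (s : Fin b)
    (h : Matched e t r s) (h' : Matched e t r' s) : r = r' := by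
  unfold Matched at h h'; ext; omega

theorem sum_ite_val_eq {R : Type*} [AddCommMonoid R] {m : ℕ} (f : Fin m → R) {c : ℕ} (hc : c < m) :
    ∑ s : Fin m, (if (s : ℕ) = c then f s else 0) = f ⟨c, hc⟩ := by
  rw [Finset.sum_eq_single ⟨c, hc⟩]
  · simp
  · intro s _ hs
    rw [if_neg fun h => hs (Fin.ext h)]
  · simp

variable {F : Type*} [Field F]

theorem isSplitting_pencil {n N t e : ℕ} (α : F) (ht : 1 ≤ t) (htN : t < N) (he : e ≤ 1)
    (hn : N + e + 2 ≤ n) {σ : Fin N ⊕ Fin (n - N) ≃ Fin n}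
    (hσ : ∀ r, (σ (Sum.inl r) : ℕ) = if (r : ℕ) < t then (r : ℕ) else r + 1)
    (hσ' : ∀ s, (σ (Sum.inr s) : ℕ) = if (s : ℕ) = 0 then t else N + s) :
    IsSplitting (rsParityCheck α 0 (N + 1 + e) n)
      (pencil ((powMatrix α n).submatrix (σ ∘ Sum.inl) id)
        ((relMatrix (Matched e t) F : Matrix (Fin N) (Fin (n - N)) F) *
          (powMatrix α n).submatrix (σ ∘ Sum.inr) id)) := by
  refine ⟨fun s => ⟨if (s : ℕ) < t then s else if (s : ℕ) = t then 0 else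
    if (s : ℕ) ≤ N then s - 1 else t, by split_ifs <;> omega⟩,
    fun s => if (s : ℕ) = t ∨ (s : ℕ) = N + 1 then 1 else 0, ?_, ?_, ?_⟩
  · intro s s' h
    simp only [Prod.mk.injEq, Fin.mk.injEq] at h
    ext
    obtain ⟨h1, h2⟩ := h
    split_ifs at h1 h2 <;> omega
  · intro r
    refine ⟨⟨if (r : ℕ) < t then (r : ℕ) else r + 1, by split_ifs <;> omega⟩, ?_, ?_⟩
    · ext
      by_cases h : (r : ℕ) < t
      · simp [h]
      · simp only [h, if_false]
        rw [if_neg (by omega), if_neg (by omega), if_pos (by omega)]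
        omega
    · dsimp only
      rw [if_neg]
      split_ifs <;> omega
  · intro r j
    set H := rsParityCheck α 0 (N + 1 + e) n with hH
    have hHW : ∀ (s : Fin (N + 1 + e)) (c : Fin n), (s : ℕ) = c → H s j = powMatrix α n c j := by
      intro s c hsc
      simp [hH, rsParityCheck, powMatrix, hsc]
    have hA : Polynomial.C ((powMatrix α n).submatrix (σ ∘ Sum.inl) id r j) =
        ∑ s : Fin (N + 1 + e), if (s : ℕ) = (if (r : ℕ) < t then (r : ℕ) else r + 1)
          then monomial 0 (H s j) else 0 := by
      rw [sum_ite_val_eq _ (by split_ifs <;> omega), monomial_zero_left]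
      congr 1
      exact (hHW _ _ (hσ r).symm).symm
    have hB : X * Polynomial.C (((relMatrix (Matched e t) F : Matrix (Fin N) (Fin (n - N)) F) *
        (powMatrix α n).submatrix (σ ∘ Sum.inr) id) r j) =
        ∑ s : Fin (N + 1 + e), if ((s : ℕ) = t ∧ (r : ℕ) = 0) ∨ ((s : ℕ) = N + 1 ∧ (r : ℕ) = t)
          then monomial 1 (H s j) else 0 := by
      by_cases hr : ∃ s : Fin (n - N), Matched e t r s
      · obtain ⟨s, hs⟩ := hr
        rw [relMatrix_mul_apply_of_rel _ (Matched.right_unique ht) _ hs]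
        have hlt : (σ (Sum.inr s) : ℕ) < N + 1 + e := by
          rw [hσ']; unfold Matched at hs; split_ifs <;> omega
        have := sum_ite_val_eq (fun s => monomial 1 (H s j)) hlt
        rw [hHW ⟨_, hlt⟩ (σ (Sum.inr s)) rfl] at this
        rw [submatrix_apply, id, Function.comp_apply, X_mul_C, C_mul_X_eq_monomial, ← this]
        refine Finset.sum_congr rfl fun s' _ => ?_
        refine if_congr ?_ rfl rfl
        rw [hσ']
        unfold Matched at hs
        split_ifs <;> omega
      · push Not at hr
        rw [relMatrix_mul_apply_of_not _ _ hr, Polynomial.C_0, mul_zero]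
        refine (Finset.sum_eq_zero fun s' _ => if_neg ?_).symm
        rintro (⟨h1, h2⟩ | ⟨h1, h2⟩)
        · exact hr ⟨0, by omega⟩ (Or.inl ⟨h2, rfl⟩)
        · exact hr ⟨1, by omega⟩ (Or.inr ⟨by omega, h2, rfl⟩)
    rw [pencil_apply, hA, hB, ← Finset.sum_add_distrib]
    refine Finset.sum_congr rfl fun s _ => ?_
    simp only [Fin.ext_iff]
    have hs := s.2
    have hr := r.2
    by_cases hd : (s : ℕ) = t ∨ (s : ℕ) = N + 1
    · rw [if_neg (c := (s : ℕ) = _) (by split_ifs <;> omega), zero_add, if_pos hd]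
      exact if_congr (by split_ifs <;> omega) rfl rfl
    · rw [if_neg (c := _ ∨ _) (by omega), add_zero, if_neg hd]
      exact if_congr (by split_ifs <;> omega) rfl rfl

open Classical in
/-- Both families of parameters at once. `G₁` has `N` rows, `1 + e` of them of degree one, and uses
the exponents `0, …, N + e`; `G₂` consists of its first `t` rows, of which only row `0` has degree
one, and uses the exponents `0, …, t`. -/
theorem exists_isRSDerivedAQCC [Fintype F] {n N t e : ℕ} (hF : n + 1 = Fintype.card F)
    (ht : 1 ≤ t) (htN : t < N) (he : e ≤ 1) (hn : N + e + 2 ≤ n) :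
    ∃ μ dz dx : ℕ, IsRSDerivedAQCC F n (N - t) μ (2 + e) dz dx ∧
      n - (N + e) ≤ dz ∧ t + 2 ≤ dx := by
  obtain ⟨α, hα⟩ : ∃ α : F, IsPrimitiveRoot α n := by
    obtain ⟨g, hg⟩ := IsCyclic.exists_generator (α := Fˣ)
    refine ⟨g, ?_⟩
    have h1 := IsPrimitiveRoot.orderOf g
    rw [orderOf_eq_card_of_forall_mem_zpowers hg, Nat.card_units, Nat.card_eq_fintype_card, ← hF,
      Nat.add_sub_cancel] at h1
    exact IsPrimitiveRoot.coe_units_iff.2 h1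
  have hinj : Function.Injective fun j : Fin n => α ^ (j : ℕ) := fun i j h =>
    Fin.ext (hα.pow_inj i.2 j.2 h)
  have hdet := isUnit_det_powMatrix hinj
  set W := powMatrix α n with hWdef
  have hW : W * W⁻¹ = 1 := Matrix.mul_nonsing_inv _ hdet
  have hW' : W⁻¹ * W = 1 := Matrix.nonsing_inv_mul _ hdet
  obtain ⟨σ, hσ, hσ'⟩ := exists_exponent_equiv htN (show N < n by omega)
  have hframe := isDualFrame_submatrix hW hW' σ
  set A := W.submatrix (σ ∘ Sum.inl) id with hA
  set B := W.submatrix (σ ∘ Sum.inr) id with hB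
  set A' := W⁻¹.submatrix id (σ ∘ Sum.inl) with hA'
  set B' := W⁻¹.submatrix id (σ ∘ Sum.inr) with hB'
  have hr := Matched.right_unique (e := e) (a := N) (b := n - N) ht
  have hl := Matched.left_unique (e := e) (t := t) (a := N) (b := n - N)
  have hP := relMatrix_mul_transpose_mul (Matched e t) F hr hl
  set P := relMatrix (Matched e t) F with hPdef
  have hG₁ := isRowReduced_pencil_relMatrix (Matched e t) hframe hr hl
  have hH₁ := isRowReduced_checkPencil (Matched e t) hframe hr hl
  set G₁ := pencil A (P * B) with hG₁def
  set H₁ := checkPencil A' B' P with hH₁def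
  have hdual : rowModule H₁ = euclideanDual (rowModule G₁) := rowModule_checkPencil hframe hP
  let f : Fin t ↪ Fin N := Fin.castLEEmb htN.le
  have hG₂ := hG₁.submatrix f
  set G₂ := G₁.submatrix f id with hG₂def
  have hS := hH₁.cssMatrix hG₂
  have horth : ∀ s r, shiftProduct (H₁ s) (G₁ r) = 0 := fun s r =>
    mem_euclideanDual_rowModule.1 (hdual ▸ Submodule.subset_span ⟨s, rfl⟩) r
  -- Row `t` of `G₁` is the first one that `G₂` omits.
  let r₀ : Fin N := ⟨t, htN⟩
  have hf : ∀ r, f r ≠ r₀ := fun r h => by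
    have h1 := congrArg Fin.val h
    have h2 : ((f r : Fin N) : ℕ) = r := rfl
    have h3 : (r₀ : ℕ) = t := rfl
    omega
  have hGA : ∀ r, ∑ j, G₁ r j * Polynomial.C (A' j r₀) = if r = r₀ then 1 else 0 := by
    intro r
    have := congrFun (congrFun (pencil_mul_map hframe P) r) r₀
    rwa [Matrix.one_apply] at this
  have hphase : (phaseWeights (cssMatrix H₁ G₂)).Nonempty := by
    refine ⟨_, G₁ r₀, undetectable_phase_of (fun s => shiftProduct_eq_zero_comm.1 (horth s r₀)) ?_,
      rfl⟩
    intro hmem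
    have hker : ∀ v ∈ rowModule G₂, ∑ j, v j * Polynomial.C (A' j r₀) = 0 := by
      intro v hv
      induction hv using Submodule.span_induction with
      | mem v hv =>
        obtain ⟨r, rfl⟩ := hv
        exact (hGA (f r)).trans (if_neg (hf r))
      | zero => simp
      | add a b _ _ ha hb => simp [add_mul, Finset.sum_add_distrib, ha, hb]
      | smul c a _ ha => simp [mul_assoc, ← Finset.mul_sum, ha]
    have h1 := hker _ hmem
    rw [hGA, if_pos rfl] at h1
    exact one_ne_zero h1
  have hflip : (flipWeights (cssMatrix H₁ G₂)).Nonempty := by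
    have hx : ∀ r, shiftProduct (G₁ r) (fun j => Polynomial.C (A' j r₀)) =
        if r = r₀ then 1 else 0 := by
      intro r
      have : shiftProduct (G₁ r) (fun j => Polynomial.C (A' j r₀)) =
          toLaurent (∑ j, G₁ r j * Polynomial.C (A' j r₀)) := by
        simp [shiftProduct]
      rw [this, hGA]
      split_ifs <;> simp
    refine ⟨_, fun j => Polynomial.C (A' j r₀), undetectable_flip_of (fun r => ?_) ?_, rfl⟩
    · exact shiftProduct_eq_zero_comm.1 ((hx (f r)).trans (if_neg (hf r)))
    · rw [hdual, mem_euclideanDual_rowModule]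
      intro hmem
      have h1 := shiftProduct_eq_zero_comm.1 (hmem r₀)
      rw [hx, if_pos rfl] at h1
      exact one_ne_zero h1
  have hdz : ∀ w ∈ phaseWeights (cssMatrix H₁ G₂), n - (N + e) ≤ w := by
    rintro _ ⟨z, hz, rfl⟩
    obtain ⟨hz1, hz0⟩ := of_undetectable_phase hz
    have := lt_weight_add_of_coordinates hinj hW' hz0 (m := N + 1 + e) fun c hc => ?_
    · omega
    obtain ⟨x, rfl⟩ := σ.surjective c
    rcases x with r | s
    · rw [hσ] at hc
      split_ifs at hc <;> omega
    · -- Exponents from `N + 1 + e` on are unused by `G₁`, so their dual vectors are rows of `H₁`.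
      have hs : ∀ r : Fin N, ¬ Matched e t r s := by
        intro r h
        rw [hσ'] at hc
        unfold Matched at h
        split_ifs at hc <;> omega
      have hrow : H₁ s = pencil B'ᵀ 0 s := by
        ext1 j
        rw [hH₁def, hPdef, checkPencil_apply_of_not _ hr hl _ _ hs, pencil_apply]
        simp
      have h1 := hz1 s
      rw [hrow, shiftProduct_pencil_const_eq_zero_iff fun _ => rfl] at h1
      exact h1
  have hdx : ∀ w ∈ flipWeights (cssMatrix H₁ G₂), t + 2 ≤ w := by
    rintro _ ⟨x, hx, rfl⟩
    obtain ⟨hx1, hx0⟩ := of_undetectable_flip hx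
    have hrowA : ∀ (r : Fin t) (j : Fin n), A (f r) j = α ^ ((j : ℕ) * (r : ℕ)) := by
      intro r j
      have h1 : (σ (Sum.inl (f r)) : ℕ) = r := (hσ (f r)).trans (if_pos r.2)
      simp only [hA, hWdef, submatrix_apply, powMatrix, of_apply, Function.comp, id, h1]
    refine le_weight_of_orthogonal hinj hx0 (fun c hc1 hct => ?_) ?_
    · have h1 : shiftProduct x (pencil A (P * B) (f ⟨c, hct⟩)) = 0 := hx1 ⟨c, hct⟩
      rw [shiftProduct_pencil_const_eq_zero_iff] at h1
      · simpa only [hrowA] using h1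
      · intro j
        refine relMatrix_mul_apply_of_not _ _ (fun s h => ?_) j
        have h2 : ((f ⟨c, hct⟩ : Fin N) : ℕ) = c := rfl
        unfold Matched at h
        omega
    · have h1 : shiftProduct x (pencil A (P * B) (f ⟨0, ht⟩)) = 0 := hx1 ⟨0, ht⟩
      rw [shiftProduct_pencil_eq_zero_iff] at h1
      have hB0 : ∀ j, (P * B) (f ⟨0, ht⟩) j = α ^ ((j : ℕ) * t) := by
        intro j
        have hm : Matched e t (f ⟨0, ht⟩) (⟨0, by omega⟩ : Fin (n - N)) := Or.inl ⟨rfl, rfl⟩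
        rw [hPdef, relMatrix_mul_apply_of_rel _ hr _ hm]
        have h2 : (σ (Sum.inr (⟨0, by omega⟩ : Fin (n - N))) : ℕ) = t := (hσ' _).trans (if_pos rfl)
        simp only [hB, hWdef, submatrix_apply, powMatrix, of_apply, Function.comp, id, h2]
      simpa only [hrowA, hB0] using h1
  have hdegree : overallConstraintLength (cssMatrix H₁ G₂) = 2 + e := by
    rw [hS.overallConstraintLength_eq, Fintype.sum_sum_type]
    simp only [Sum.elim_inl, Sum.elim_inr, Function.comp]
    have h1 : ∀ s : Fin (n - N), (if ∃ r : Fin N, Matched e t r s then 1 else 0 : ℕ) =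
        (if (s : ℕ) = 0 then 1 else 0) + (if (s : ℕ) = 1 then e else 0) := by
      intro s
      by_cases hs : ∃ r : Fin N, Matched e t r s
      · obtain ⟨r, h⟩ := hs
        rw [if_pos ⟨r, h⟩]
        unfold Matched at h
        split_ifs <;> omega
      · rw [if_neg hs]
        push Not at hs
        have h2 := hs ⟨0, by omega⟩
        have h3 := hs r₀
        have h4 : (r₀ : ℕ) = t := rfl
        simp only [Matched, true_and] at h2 h3
        split_ifs <;> omega
    have h2 : ∀ r : Fin t, (if ∃ s : Fin (n - N), Matched e t (f r) s then 1 else 0 : ℕ) =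
        if (r : ℕ) = 0 then 1 else 0 := by
      intro r
      refine if_congr ⟨?_, fun h => ⟨⟨0, by omega⟩, Or.inl ⟨h, rfl⟩⟩⟩ rfl rfl
      rintro ⟨s, h⟩
      have h2 : ((f r : Fin N) : ℕ) = r := rfl
      have := r.2
      unfold Matched at h
      omega
    trans ∑ s : Fin (n - N), ((if (s : ℕ) = 0 then 1 else 0) + (if (s : ℕ) = 1 then e else 0)) +
      ∑ r : Fin t, if (r : ℕ) = 0 then 1 else 0
    · refine congrArg₂ (· + ·) (Finset.sum_congr rfl fun s _ => ?_)
        (Finset.sum_congr rfl fun r _ => ?_)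
      · convert h1 s
      · convert h2 r
    rw [Finset.sum_add_distrib, sum_ite_val_eq (fun _ => 1) (by omega),
      sum_ite_val_eq (fun _ => e) (by omega), sum_ite_val_eq (fun _ => 1) (by omega)]
    omega
  refine ⟨memory (cssMatrix H₁ G₂), sInf (phaseWeights (cssMatrix H₁ G₂)),
    sInf (flipWeights (cssMatrix H₁ G₂)), ⟨hF, α, 0, N + 1 + e, N, t, n - N, G₁, G₂, H₁, hα,
      by omega, by omega, isSplitting_pencil α ht htN he hn hσ hσ', hG₁.isReducedBasic, ⟨f, rfl⟩,
      hG₂.isReducedBasic, hH₁.isReducedBasic, hdual, ?_⟩,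
    hdz _ (Nat.sInf_mem hphase), hdx _ (Nat.sInf_mem hflip)⟩
  have hred := hS.isReducedBasic
  exact
    { card_rows := by simp; omega
      self_orthogonal := cssMatrix_self_orthogonal fun s r => horth s (f r)
      reduced_basic := by convert hred
      degree_eq := hdegree
      memory_eq := rfl
      dz_isLeast := ⟨Nat.sInf_mem hphase, fun _ => Nat.sInf_le⟩
      dx_isLeast := ⟨Nat.sInf_mem hflip, fun _ => Nat.sInf_le⟩ }

end Construction

end AQCC

theorem theorem6 {F : Type*} [Field F] [Fintype F] (q : ℕ) (hF : Fintype.card F = q)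
    (hq : 8 ≤ q) :
    (∀ i t : ℕ, 3 ≤ i → i ≤ q - 3 → 1 ≤ t → t ≤ i - 2 →
      ∃ μ dz dx : ℕ, AQCC.IsRSDerivedAQCC F (q - 1) (i - t - 1) μ 3 dz dx ∧
        q - i - 1 ≤ dz ∧ t + 2 ≤ dx) ∧
    (∀ i t : ℕ, 2 ≤ i → i ≤ q - 3 → 1 ≤ t → t ≤ i - 1 →
      ∃ μ dz dx : ℕ, AQCC.IsRSDerivedAQCC F (q - 1) (i - t) μ 2 dz dx ∧
        q - i - 1 ≤ dz ∧ t + 2 ≤ dx) := by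
  have hn : q - 1 + 1 = Fintype.card F := by omega
  constructor
  · intro i t hi hiq ht hti
    obtain ⟨μ, dz, dx, h, hz, hx⟩ := AQCC.exists_isRSDerivedAQCC (N := i - 1) (e := 1) hn ht
      (by omega) le_rfl (by omega)
    rw [show i - 1 - t = i - t - 1 by omega] at h
    exact ⟨μ, dz, dx, h, by omega, hx⟩
  · intro i t hi hiq ht hti
    obtain ⟨μ, dz, dx, h, hz, hx⟩ := AQCC.exists_isRSDerivedAQCC (N := i) (e := 0) hn ht
      (by omega) zero_le_one (by omega)
    exact ⟨μ, dz, dx, h, by omega, hx⟩
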